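/- Let $1\le p\le n$ be integers and let $f\colon\mathbb{C}^p\to\mathbb{P}^n(\mathbb{C})$ be a holomorphic map which is linearly nondegenerate (its image is contained in no hyperplane of $\mathbb{P}^n(\mathbb{C})$) and of maximal rank (at some point $z\in\mathbb{C}^p$ the differential $df$ has rank $\min\{p,n\}=p$). Let $[f_0:\dots:f_n]$ be a reduced representation of $f$, i.e. $f_0,\dots,f_n$ are entire functions on $\mathbb{C}^p$ without common zeros such that $f(z)=[f_0(z):\dots:f_n(z)]$ for all $z\in\mathbb{C}^p$. For $\alpha\in\mathbb{Z}_{\ge0}^p$ put $\Delta^\alpha=\partial^{|\alpha|}/\partial z_1^{\alpha_1}\cdots\partial z_p^{\alpha_p}$, an operator of order $|\alpha|=\alpha_1+\dots+\alpha_p$. A family $\mathcal{S}=\{\Delta^{s}\}_{0\le s\le n}$ of $n+1$ such operators is called admissible if $\Delta^{s}$ has order at most $s$ for every $0\le s\le n$, and its generalized Wronskian is $W_{\mathcal S}(f_0,\dots,f_n)=\det\big(\Delta^{s}f_j\big)_{0\le s,j\le n}$. Then there exists an admissible family $\mathcal{S}=\{\Delta^s\}_{0\le s\le n}$ containing at least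 $p$ (distinct) differential operators of order $1$ such that $W_{\mathcal S}(f_0,\dots,f_n)\not\equiv0$ on $\mathbb{C}^p$. -/

import Mathlib

open scoped LinearAlgebra.Projectivization

namespace GenWronskian

/-- The complex space `ℂ^p`. -/
abbrev Cp (p : ℕ) : Type := Fin p → ℂ

/-- Complex projective space `ℙ^n(ℂ)`, with homogeneous coordinates indexed by `0, …, n`. -/
abbrev CPn (n : ℕ) : Type := ℙ ℂ (Fin (n + 1) → ℂ)

/-- The standard affine open set `U_i = {ω_i ≠ 0}` of `ℙ^n(ℂ)`. -/
def affineOpen {n : ℕ} (i : Fin (n + 1)) : Set (CPn n) := {P | P.rep i ≠ 0}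

/-- The standard affine chart `[ω_0 : … : ω_n] ↦ (ω_j / ω_i)_{j ≠ i}` of `ℙ^n(ℂ)`, meaningful on
`U_i`; the indices `j ≠ i` are listed in increasing order by `i.succAbove`. -/
noncomputable def affineChart {n : ℕ} (i : Fin (n + 1)) (P : CPn n) : Fin n → ℂ :=
  fun j => P.rep (i.succAbove j) / P.rep i

/-- Membership in `U_i` can be read off any representative. -/
theorem mk_mem_affineOpen {n : ℕ} (i : Fin (n + 1)) (v : Fin (n + 1) → ℂ) (hv : v ≠ 0) :
    Projectivization.mk ℂ v hv ∈ affineOpen i ↔ v i ≠ 0 := by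
  obtain ⟨a, ha⟩ := Projectivization.exists_smul_eq_mk_rep ℂ v hv
  simp [affineOpen, ← ha, Units.smul_def]

/-- The affine chart can be computed from any representative. -/
theorem affineChart_mk {n : ℕ} (i : Fin (n + 1)) (v : Fin (n + 1) → ℂ) (hv : v ≠ 0) :
    affineChart i (Projectivization.mk ℂ v hv) = fun j => v (i.succAbove j) / v i := by
  obtain ⟨a, ha⟩ := Projectivization.exists_smul_eq_mk_rep ℂ v hv
  funext j
  simp [affineChart, ← ha, Units.smul_def, mul_div_mul_left]

/-- A map `f : ℂ^p → ℙ^n(ℂ)` is holomorphic if, for every standard affine chart, the preimage of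
its domain is open and `f` read in the chart is holomorphic there. -/
def IsHolomorphicMap {p n : ℕ} (f : Cp p → CPn n) : Prop :=
  ∀ i : Fin (n + 1), IsOpen (f ⁻¹' affineOpen i) ∧
    DifferentiableOn ℂ (fun z => affineChart i (f z)) (f ⁻¹' affineOpen i)

/-- `f` is of maximal rank if at some point the differential of `f`, computed in an affine chart
around the image point, has rank `min p n`. (The rank does not depend on the chart.) -/
def IsOfMaximalRank {p n : ℕ} (f : Cp p → CPn n) : Prop :=
  ∃ (z : Cp p) (i : Fin (n + 1)), f z ∈ affineOpen i ∧
    Module.finrank ℂ (fderiv ℂ (fun w => affineChart i (f w)) z).range = min p n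

/-- The zero locus in `ℙ^n(ℂ)` of a linear form; a hyperplane when the form is nonzero. -/
def hyperplane {n : ℕ} (l : Module.Dual ℂ (Fin (n + 1) → ℂ)) : Set (CPn n) := {P | l P.rep = 0}

/-- `f` is linearly nondegenerate if its image is not contained in any hyperplane. -/
def IsLinearlyNondegenerate {p n : ℕ} (f : Cp p → CPn n) : Prop :=
  ∀ l : Module.Dual ℂ (Fin (n + 1) → ℂ), l ≠ 0 → ¬ Set.range f ⊆ hyperplane l

/-- `(F_0, …, F_n)` is a reduced representation of the holomorphic map `f`: the `F_j` are entire
functions on `ℂ^p` without common zeros, and `f = [F_0 : … : F_n]`. -/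
def IsReducedRepresentation {p n : ℕ} (F : Fin (n + 1) → Cp p → ℂ) (f : Cp p → CPn n) : Prop :=
  (∀ j, Differentiable ℂ (F j)) ∧
    ∀ z, ∃ h : (fun j => F j z) ≠ 0, f z = Projectivization.mk ℂ (fun j => F j z) h

/-- The partial derivative `∂g/∂z_i`. -/
noncomputable def partialDeriv {p : ℕ} (i : Fin p) (g : Cp p → ℂ) : Cp p → ℂ :=
  fun z => fderiv ℂ g z (Pi.single i 1)

/-- The differential operator `Δ^α = ∂^{|α|} / ∂z_1^{α_1} ⋯ ∂z_p^{α_p}`. -/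
noncomputable def diffOp {p : ℕ} (α : Fin p → ℕ) (g : Cp p → ℂ) : Cp p → ℂ :=
  (List.finRange p).foldr (fun i h => (partialDeriv i)^[α i] h) g

/-- The order `|α| = α_1 + ⋯ + α_p` of `Δ^α`. -/
def order {p : ℕ} (α : Fin p → ℕ) : ℕ := ∑ i, α i

/-- A family `(Δ^s)_{0 ≤ s ≤ n}` of operators, given by their multi-indices, is admissible if
`Δ^s` has order at most `s` for all `s`. -/
def IsAdmissible {p n : ℕ} (S : Fin (n + 1) → Fin p → ℕ) : Prop :=
  ∀ s : Fin (n + 1), order (S s) ≤ (s : ℕ)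

/-- The generalized Wronskian `W_S(F_0, …, F_n) = det (Δ^s F_j)_{s,j}`. -/
noncomputable def genWronskian {p n : ℕ} (S : Fin (n + 1) → Fin p → ℕ)
    (F : Fin (n + 1) → Cp p → ℂ) : Cp p → ℂ :=
  fun z => (Matrix.of fun s j : Fin (n + 1) => diffOp (S s) (F j) z).det

end GenWronskian

namespace GenWronskian

open Filter Topology

/-! At an immersion point the vector `F` and its `p` first partial derivatives are independent
(`linearIndependent_of_isOfMaximalRank`); these are the first `p + 1` rows. Rows are then added one
at a time (`exists_linearIndependent_snoc`), with no old row discarded. If no operator of the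
allowed order ever enlarged the family, the span of its rows would be closed under differentiation
near some point, hence locally constant (`eventually_mem_span_of_partialDeriv_mem_span`). `F` itself
lies in this proper subspace, so by the identity theorem its image would lie in a hyperplane. -/

/-! ### Partial derivatives of entire functions -/

theorem fderiv_apply_eq_deriv {p : ℕ} {g : Cp p → ℂ} (hg : Differentiable ℂ g) (z v : Cp p) :
    fderiv ℂ g z v = deriv (fun t : ℂ => g (z + t • v)) 0 := by
  have h := (hg (z + (0 : ℂ) • v)).hasFDerivAt.comp_hasDerivAt (0 : ℂ)
    (((hasDerivAt_id (0 : ℂ)).smul_const v).const_add z)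
  simpa [Function.comp_def] using h.deriv.symm

/-- Cauchy's estimate on the unit circle of each complex line through `z`. -/
theorem norm_fderiv_le_of_entire {p : ℕ} {g : Cp p → ℂ} (hg : Differentiable ℂ g) {z : Cp p}
    {C : ℝ} (hC : ∀ w ∈ Metric.closedBall z 1, ‖g w‖ ≤ C) : ‖fderiv ℂ g z‖ ≤ C := by
  have hC0 : 0 ≤ C := (norm_nonneg _).trans (hC z (by simp))
  refine ContinuousLinearMap.opNorm_le_of_unit_norm hC0 fun v hv => ?_
  rw [fderiv_apply_eq_deriv hg]
  have hd : Differentiable ℂ (fun t : ℂ => g (z + t • v)) := by fun_prop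
  have := Complex.norm_deriv_le_of_forall_mem_sphere_norm_le (c := 0) one_pos
    (C := C) hd.diffContOnCl fun t ht => hC _ (by
      have : ‖t‖ = 1 := by simpa using ht
      simp [norm_smul, this, hv])
  simpa using this

/-- Partial derivatives of entire functions of several variables are entire. -/
theorem differentiable_partialDeriv {p : ℕ} {g : Cp p → ℂ} (hg : Differentiable ℂ g)
    (i : Fin p) : Differentiable ℂ (partialDeriv i g) := by
  set e : Cp p := Pi.single i 1 with he
  have hen : ‖e‖ = 1 := by rw [he, Pi.norm_single, norm_one]
  -- Cauchy's formula trades the derivative for an integral of `g` itself, which can be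
  -- differentiated in `z` under the integral sign.
  have key : partialDeriv i g = fun z => (2 * Real.pi * Complex.I : ℂ)⁻¹ •
      ∮ ζ in C(0, 1), ((ζ - 0) ^ 2)⁻¹ • g (z + ζ • e) := by
    funext z
    have hd : Differentiable ℂ (fun t : ℂ => g (z + t • e)) := by fun_prop
    rw [Complex.two_pi_I_inv_smul_circleIntegral_sub_sq_inv_smul_of_differentiable isOpen_univ
      (Set.subset_univ _) hd.differentiableOn (by simp)]
    exact fderiv_apply_eq_deriv hg z e
  rw [key]
  intro z₀
  refine DifferentiableAt.fun_const_smul ?_ _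
  -- Radius 3 = 1 for the moving base point, 1 for the circle, 1 for Cauchy's estimate.
  obtain ⟨C, hC⟩ := (isCompact_closedBall z₀ 3).exists_bound_of_continuousOn
    hg.continuous.continuousOn
  have hcircle : ∀ θ : ℝ, ‖circleMap 0 1 θ‖ = 1 := fun θ => by simp
  have hne : ∀ θ : ℝ, circleMap 0 1 θ ≠ 0 := fun θ => circleMap_ne_center one_ne_zero
  have hcm : Continuous (circleMap 0 1) := continuous_circleMap 0 1
  let c : ℝ → ℂ := fun θ => deriv (circleMap 0 1) θ * ((circleMap 0 1 θ - 0) ^ 2)⁻¹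
  have hc : Continuous c := by
    simp only [c, deriv_circleMap, sub_zero]
    exact (hcm.mul continuous_const).mul ((hcm.pow 2).inv₀ fun θ => pow_ne_zero 2 (hne θ))
  have hcn : ∀ θ, ‖c θ‖ = 1 := fun θ => by simp [c, deriv_circleMap]
  have hcont : ∀ x, Continuous fun θ : ℝ => c θ • g (x + circleMap 0 1 θ • e) := fun x =>
    hc.smul (hg.continuous.comp (continuous_const.add (hcm.smul continuous_const)))
  have hmain := intervalIntegral.hasFDerivAt_integral_of_dominated_of_fderiv_le
    (𝕜 := ℂ) (μ := MeasureTheory.volume) (a := 0) (b := 2 * Real.pi) (s := Metric.ball z₀ 1)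
    (bound := fun _ => C) (x₀ := z₀)
    (F := fun x θ => c θ • g (x + circleMap 0 1 θ • e))
    (F' := fun x θ => c θ • fderiv ℂ g (x + circleMap 0 1 θ • e))
    (Metric.ball_mem_nhds _ one_pos)
    (Eventually.of_forall fun x => (hcont x).aestronglyMeasurable)
    ((hcont z₀).intervalIntegrable _ _)
    (by
      have : ProperSpace (Cp p →L[ℂ] ℂ) := FiniteDimensional.proper ℂ _
      refine (hc.stronglyMeasurable.smul (Measurable.stronglyMeasurable ?_)).aestronglyMeasurable
      exact (measurable_fderiv ℂ g).comp
        (continuous_const.add (hcm.smul continuous_const)).measurable)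
    (by
      refine Eventually.of_forall fun θ _ x hx => ?_
      rw [norm_smul, hcn, one_mul]
      refine norm_fderiv_le_of_entire hg fun w hw => hC w ?_
      rw [mem_closedBall_iff_norm] at hw ⊢
      rw [mem_ball_iff_norm] at hx
      have h1 : ‖circleMap 0 1 θ • e‖ = 1 := by rw [norm_smul, hcircle, hen, one_mul]
      calc ‖w - z₀‖ = ‖(w - (x + circleMap 0 1 θ • e)) + (x - z₀) + circleMap 0 1 θ • e‖ := by
            congr 1; abel
        _ ≤ ‖w - (x + circleMap 0 1 θ • e)‖ + ‖x - z₀‖ + ‖circleMap 0 1 θ • e‖ := norm_add₃_le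
        _ ≤ 3 := by linarith)
    intervalIntegrable_const
    (by
      refine Eventually.of_forall fun θ _ x _ => ?_
      have := (hg (x + circleMap 0 1 θ • e)).hasFDerivAt.comp x
        ((hasFDerivAt_id x).add_const (circleMap 0 1 θ • e))
      exact (this.const_smul (c θ)))
  refine hmain.differentiableAt.congr_of_eventuallyEq (Eventually.of_forall fun x => ?_)
  simp only [circleIntegral, c, smul_eq_mul, mul_assoc]

theorem fderiv_apply_eq_sum {p : ℕ} (g : Cp p → ℂ) (z v : Cp p) :
    fderiv ℂ g z v = ∑ i, v i * partialDeriv i g z := by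
  conv_lhs => rw [← LinearMap.sum_single_apply (fun _ => ℂ) v]
  simp only [map_sum, partialDeriv]
  refine Finset.sum_congr rfl fun i _ => ?_
  rw [← smul_eq_mul, ← map_smul]
  congr 1
  ext j
  simp [Pi.single_apply]

theorem differentiable_fderiv {p : ℕ} {g : Cp p → ℂ} (hg : Differentiable ℂ g) :
    Differentiable ℂ (fderiv ℂ g) := by
  have : fderiv ℂ g = fun z => ∑ i, partialDeriv i g z •
      (ContinuousLinearMap.proj i : Cp p →L[ℂ] ℂ) := by
    funext z
    ext v
    simp [fderiv_apply_eq_sum, mul_comm]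
  rw [this]
  exact Differentiable.fun_sum fun i _ => (differentiable_partialDeriv hg i).smul_const _

theorem partialDeriv_comm {p : ℕ} {g : Cp p → ℂ} (hg : Differentiable ℂ g) (i j : Fin p) :
    partialDeriv i (partialDeriv j g) = partialDeriv j (partialDeriv i g) := by
  have key : ∀ (i j : Fin p) z, partialDeriv i (partialDeriv j g) z =
      fderiv ℂ (fderiv ℂ g) z (Pi.single i 1) (Pi.single j 1) := fun i j z => by
    have h := (differentiable_fderiv hg z).hasFDerivAt.clm_apply
      (hasFDerivAt_const (Pi.single j (1 : ℂ) : Cp p) z)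
    have h2 : fderiv ℂ (partialDeriv j g) z = _ := h.fderiv
    simp [partialDeriv] at h2 ⊢
    simp [h2]
  funext z
  rw [key, key]
  exact second_derivative_symmetric (fun y => (hg y).hasFDerivAt)
    (differentiable_fderiv hg z).hasFDerivAt _ _

/-! ### The operators `diffOp α` -/

theorem differentiable_iterate_partialDeriv {p : ℕ} {g : Cp p → ℂ} (hg : Differentiable ℂ g)
    (i : Fin p) (m : ℕ) : Differentiable ℂ ((partialDeriv i)^[m] g) := by
  induction m with
  | zero => exact hg
  | succ m ih =>
    rw [Function.iterate_succ_apply']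
    exact differentiable_partialDeriv ih i

theorem partialDeriv_iterate_comm {p : ℕ} {g : Cp p → ℂ} (hg : Differentiable ℂ g)
    (i j : Fin p) (m : ℕ) :
    partialDeriv i ((partialDeriv j)^[m] g) = (partialDeriv j)^[m] (partialDeriv i g) := by
  induction m with
  | zero => rfl
  | succ m ih =>
    rw [Function.iterate_succ_apply', Function.iterate_succ_apply', ← ih,
      partialDeriv_comm (differentiable_iterate_partialDeriv hg j m)]

theorem differentiable_foldr_partialDeriv {p : ℕ} {g : Cp p → ℂ} (hg : Differentiable ℂ g)
    (α : Fin p → ℕ) (l : List (Fin p)) :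
    Differentiable ℂ (l.foldr (fun i h => (partialDeriv i)^[α i] h) g) := by
  induction l with
  | nil => exact hg
  | cons j l ih => exact differentiable_iterate_partialDeriv ih j _

theorem differentiable_diffOp {p : ℕ} {g : Cp p → ℂ} (hg : Differentiable ℂ g)
    (α : Fin p → ℕ) : Differentiable ℂ (diffOp α g) :=
  differentiable_foldr_partialDeriv hg α _

/-- Stated for partial lists so that the induction can move the extra derivative outward past the
other variables; `Nodup` ensures it is counted once. -/
theorem partialDeriv_foldr {p : ℕ} {g : Cp p → ℂ} (hg : Differentiable ℂ g) (α : Fin p → ℕ)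
    (i : Fin p) (l : List (Fin p)) (hl : l.Nodup) :
    l.foldr (fun j h => (partialDeriv j)^[(α + Pi.single i 1 : Fin p → ℕ) j] h) g =
      if i ∈ l then partialDeriv i (l.foldr (fun j h => (partialDeriv j)^[α j] h) g)
      else l.foldr (fun j h => (partialDeriv j)^[α j] h) g := by
  induction l with
  | nil => simp
  | cons j l ih =>
    have hd := differentiable_foldr_partialDeriv hg α l
    rw [List.nodup_cons] at hl
    simp only [List.foldr_cons, ih hl.2, List.mem_cons]
    by_cases hij : i = j
    · subst hij
      simp [hl.1, Function.iterate_succ_apply']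
    · have : (α + Pi.single i 1 : Fin p → ℕ) j = α j := by simp [Ne.symm hij]
      simp only [this, hij, false_or]
      split_ifs
      · rw [partialDeriv_iterate_comm hd]
      · rfl

theorem diffOp_add_single {p : ℕ} {g : Cp p → ℂ} (hg : Differentiable ℂ g) (α : Fin p → ℕ)
    (i : Fin p) : diffOp (α + Pi.single i 1) g = partialDeriv i (diffOp α g) := by
  rw [diffOp, partialDeriv_foldr hg α i _ (List.nodup_finRange p), if_pos (List.mem_finRange i)]
  rfl

theorem diffOp_zero {p : ℕ} (g : Cp p → ℂ) : diffOp 0 g = g := by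
  simp [diffOp]

theorem diffOp_single {p : ℕ} {g : Cp p → ℂ} (hg : Differentiable ℂ g) (i : Fin p) :
    diffOp (Pi.single i 1) g = partialDeriv i g := by
  simpa [diffOp_zero] using diffOp_add_single hg 0 i

theorem order_add_single {p : ℕ} (α : Fin p → ℕ) (i : Fin p) :
    order (α + Pi.single i 1) = order α + 1 := by
  simp [order, Finset.sum_add_distrib]

theorem order_zero {p : ℕ} : order (0 : Fin p → ℕ) = 0 := by
  simp [order]

theorem order_single {p : ℕ} (i : Fin p) : order (Pi.single i 1) = 1 := by
  simp [order]

/-! ### Holomorphic frames with constant span -/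

theorem exists_mul_eq_one_of_linearIndependent_rows {m q : ℕ}
    (A : Matrix (Fin m) (Fin q) ℂ) (hA : LinearIndependent ℂ A.row) :
    ∃ B : Matrix (Fin q) (Fin m) ℂ, A * B = 1 := by
  obtain ⟨L, hL⟩ := LinearMap.exists_leftInverse_of_injective (Fintype.linearCombination ℂ A.row)
    (LinearMap.ker_eq_bot.2 (linearIndependent_iff_injective_fintypeLinearCombination.1 hA))
  refine ⟨Matrix.of fun j t => L (Pi.single j 1) t, ?_⟩
  ext s t
  have h := congrFun (LinearMap.congr_fun hL (Pi.single s 1)) t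
  simp only [LinearMap.comp_apply, Fintype.linearCombination_apply_single, one_smul,
    LinearMap.id_apply] at h
  rw [LinearMap.pi_apply_eq_sum_univ L (A.row s)] at h
  simp only [Finset.sum_apply, Pi.smul_apply, smul_eq_mul] at h
  rw [Matrix.mul_apply, Matrix.one_apply, ← Pi.single_apply, Pi.single_comm, ← h]
  refine Finset.sum_congr rfl fun j _ => ?_
  have hsingle : (fun i => if j = i then (1 : ℂ) else 0) = Pi.single j 1 := by
    ext x
    simp [Pi.single_apply, eq_comm]
  rw [hsingle, Matrix.of_apply, Matrix.row]

theorem differentiable_matrix_det {E : Type*} [NormedAddCommGroup E] [NormedSpace ℂ E] {m : ℕ}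
    {A : E → Matrix (Fin m) (Fin m) ℂ} (hA : ∀ s t, Differentiable ℂ fun z => A z s t) :
    Differentiable ℂ fun z => (A z).det := by
  simp only [Matrix.det_apply]
  fun_prop

theorem differentiable_matrix_adjugate {E : Type*} [NormedAddCommGroup E] [NormedSpace ℂ E]
    {m : ℕ} {A : E → Matrix (Fin m) (Fin m) ℂ} (hA : ∀ s t, Differentiable ℂ fun z => A z s t)
    (s t : Fin m) : Differentiable ℂ fun z => (A z).adjugate s t := by
  simp only [Matrix.adjugate_apply]
  refine differentiable_matrix_det fun a b => ?_
  by_cases h : a = t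
  · subst h
    simp
  · simpa [Matrix.updateRow_ne h] using hA a b

theorem partialDeriv_sum_mul {p m : ℕ} (i : Fin p) {a b : Fin m → Cp p → ℂ} {z : Cp p}
    (ha : ∀ t, DifferentiableAt ℂ (a t) z) (hb : ∀ t, DifferentiableAt ℂ (b t) z) :
    partialDeriv i (fun w => ∑ t, a t w * b t w) z =
      ∑ t, (partialDeriv i (a t) z * b t z + a t z * partialDeriv i (b t) z) := by
  have h : HasFDerivAt (fun w => ∑ t, a t w * b t w) _ z :=
    HasFDerivAt.fun_sum fun t _ => (ha t).hasFDerivAt.mul (hb t).hasFDerivAt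
  simp only [partialDeriv, h.fderiv, sum_apply, add_apply,
    smul_apply, smul_eq_mul]
  exact Finset.sum_congr rfl fun t _ => by ring

/-- A holomorphic frame whose partial derivatives stay in its own span has constant span. -/
theorem eventually_mem_span_of_partialDeriv_mem_span {p m q : ℕ}
    {R : Cp p → Matrix (Fin m) (Fin q) ℂ} (hR : ∀ s j, Differentiable ℂ fun z => R z s j)
    {z₀ : Cp p} (hli : LinearIndependent ℂ (R z₀).row)
    (hspan : ∀ᶠ z in 𝓝 z₀, ∀ i s, (fun j => partialDeriv i (fun w => R w s j) z) ∈
      Submodule.span ℂ (Set.range (R z).row)) :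
    ∀ᶠ z in 𝓝 z₀, ∀ s, R z s ∈ Submodule.span ℂ (Set.range (R z₀).row) := by
  obtain ⟨B, hB⟩ := exists_mul_eq_one_of_linearIndependent_rows _ hli
  set M : Cp p → Matrix (Fin m) (Fin m) ℂ := fun z => R z * B with hM
  have hMd : ∀ s t, Differentiable ℂ fun z => M z s t := fun s t => by
    simp only [hM, Matrix.mul_apply]
    fun_prop
  have hdet := differentiable_matrix_det hMd
  have hadj := differentiable_matrix_adjugate hMd
  have hdet0 : ∀ᶠ z in 𝓝 z₀, (M z).det ≠ 0 :=
    hdet.continuous.continuousAt.eventually_ne (by simp [hM, hB])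
  obtain ⟨ε, hε, hball⟩ := Metric.eventually_nhds_iff_ball.1 (hdet0.and hspan)
  -- Normalized frame: same row span as `R z`, but with `N z * B = 1`. This rigidity makes `N`
  -- constant once the span is closed under differentiation.
  set N : Cp p → Matrix (Fin m) (Fin q) ℂ := fun z => (M z)⁻¹ * R z with hN
  have hMN : ∀ z ∈ Metric.ball z₀ ε, M z * N z = R z := fun z hz => by
    rw [hN, ← Matrix.mul_assoc, Matrix.mul_nonsing_inv _ (hball z hz).1.isUnit, Matrix.one_mul]
  have hNd : ∀ z ∈ Metric.ball z₀ ε, ∀ s j, DifferentiableAt ℂ (fun w => N w s j) z := by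
    intro z hz s j
    have h0 := (hball z hz).1
    simp only [hN, Matrix.mul_apply, Matrix.inv_def, Matrix.smul_apply, Ring.inverse_eq_inv']
    have h1 : DifferentiableAt ℂ (fun w => ((M w).det)⁻¹) z := (hdet z).inv h0
    exact DifferentiableAt.fun_sum fun t _ =>
      (h1.smul (hadj s t z)).mul (hR t j z)
  have hN' : ∀ z ∈ Metric.ball z₀ ε, ∀ i s j, partialDeriv i (fun w => N w s j) z = 0 := by
    intro z hz i
    have hmem := (hball z hz).2 i
    simp only [Submodule.mem_span_range_iff_exists_fun] at hmem
    choose A hA using hmem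
    set dR : Matrix (Fin m) (Fin q) ℂ :=
      Matrix.of fun s j => partialDeriv i (fun w => R w s j) z with hdR
    set dM : Matrix (Fin m) (Fin m) ℂ :=
      Matrix.of fun s j => partialDeriv i (fun w => M w s j) z with hdM
    set dN : Matrix (Fin m) (Fin q) ℂ :=
      Matrix.of fun s j => partialDeriv i (fun w => N w s j) z with hdN
    have h1 : dR = Matrix.of A * R z := by
      ext s j
      simpa [hdR, Matrix.mul_apply] using (congrFun (hA s) j).symm
    have h2 : dM = dR * B := by
      ext s t
      simp only [hdM, hM, hdR, Matrix.mul_apply, Matrix.of_apply]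
      rw [partialDeriv_sum_mul i (fun j => hR s j z) fun j => differentiableAt_const _]
      simp [partialDeriv]
    have h3 : dR = dM * N z + M z * dN := by
      ext s j
      simp only [hdR, hdM, hdN, Matrix.add_apply, Matrix.mul_apply, Matrix.of_apply]
      rw [← Finset.sum_add_distrib, ← partialDeriv_sum_mul i (fun t => hMd s t z)
        fun t => hNd z hz t j]
      refine congrArg (fun L : Cp p →L[ℂ] ℂ => L _) (Filter.EventuallyEq.fderiv_eq ?_)
      filter_upwards [Metric.isOpen_ball.mem_nhds hz] with w hw
      rw [← Matrix.mul_apply, hMN w hw]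
    -- With `dR = A R` one gets `dM = A R B = A M`, so `dM N = A M N = A R = dR`, and the product
    -- rule leaves `M dN = 0`.
    have h4 : M z * dN = 0 := by
      have : dM * N z = dR := by
        rw [h2, h1, Matrix.mul_assoc, Matrix.mul_assoc, ← Matrix.mul_assoc (R z), hMN z hz]
      rwa [this, left_eq_add] at h3
    have h5 : dN = 0 := by
      rw [← Matrix.one_mul dN, ← Matrix.nonsing_inv_mul _ (hball z hz).1.isUnit,
        Matrix.mul_assoc, h4, Matrix.mul_zero]
    exact fun s j => congrFun (congrFun h5 s) j
  have hNc : ∀ z ∈ Metric.ball z₀ ε, N z = N z₀ := fun z hz => by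
    ext s j
    refine Metric.isOpen_ball.is_const_of_fderiv_eq_zero (𝕜 := ℂ)
      (f := fun w => N w s j) (convex_ball z₀ ε).isPreconnected
      (fun w hw => (hNd w hw s j).differentiableWithinAt) (fun w hw => ?_) hz
      (Metric.mem_ball_self hε)
    ext v
    rw [fderiv_apply_eq_sum]
    simp [hN' w hw]
  have hN0 : N z₀ = R z₀ := by simp [hN, hM, hB]
  filter_upwards [Metric.ball_mem_nhds z₀ hε] with z hz s
  rw [← hMN z hz, hNc z hz, hN0, Submodule.mem_span_range_iff_exists_fun]
  refine ⟨M z s, ?_⟩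
  ext j
  simp [Matrix.mul_apply]

/-- An entire function vanishing near a point vanishes identically. -/
theorem eq_zero_of_eventuallyEq_zero {p : ℕ} {g : Cp p → ℂ} (hg : Differentiable ℂ g)
    {z₀ : Cp p} (h : ∀ᶠ z in 𝓝 z₀, g z = 0) (z : Cp p) : g z = 0 := by
  have hd : Differentiable ℂ fun t : ℂ => g (z₀ + t • (z - z₀)) := by fun_prop
  have hA : AnalyticOnNhd ℂ (fun t : ℂ => g (z₀ + t • (z - z₀))) Set.univ :=
    fun t _ => hd.analyticAt t
  have hc : Tendsto (fun t : ℂ => z₀ + t • (z - z₀)) (𝓝 0) (𝓝 z₀) :=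
    Continuous.tendsto' (by fun_prop) _ _ (by simp)
  have := congrFun (hA.eq_of_eventuallyEq (g := 0) (fun t _ => analyticAt_const)
    (z₀ := 0) (hc.eventually h)) 1
  simpa using this

/-! ### Building the independent rows -/

/-- The row `(Δ^α F_0, …, Δ^α F_n)` of a generalized Wronskian matrix. -/
noncomputable def wronskianRow {p n : ℕ} (F : Fin (n + 1) → Cp p → ℂ) (z : Cp p)
    (α : Fin p → ℕ) : Fin (n + 1) → ℂ :=
  fun j => diffOp α (F j) z

theorem exists_linearIndependent_snoc {p n k : ℕ} {F : Fin (n + 1) → Cp p → ℂ}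
    (hF : ∀ j, Differentiable ℂ (F j))
    (hlin : ∀ l : Module.Dual ℂ (Fin (n + 1) → ℂ), l ≠ 0 → ∃ z, l (fun j => F j z) ≠ 0)
    (hk : k < n) {S : Fin (k + 1) → Fin p → ℕ} (hS : ∀ s, order (S s) ≤ s) {z₀ : Cp p}
    (hli : LinearIndependent ℂ (wronskianRow F z₀ ∘ S)) :
    ∃ α : Fin p → ℕ, order α ≤ k + 1 ∧
      ∃ z, LinearIndependent ℂ (wronskianRow F z ∘ (Fin.snoc S α : Fin (k + 2) → Fin p → ℕ)) := by
  by_contra! hcon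
  let R : Cp p → Matrix (Fin (k + 1)) (Fin (n + 1)) ℂ := fun z =>
    Matrix.of fun s => wronskianRow F z (S s)
  have hR : ∀ s j, Differentiable ℂ fun z => R z s j := fun s j =>
    differentiable_diffOp (hF j) (S s)
  have hRli : LinearIndependent ℂ (R z₀).row := hli
  have hev : ∀ᶠ z in 𝓝 z₀, LinearIndependent ℂ (R z).row := by
    refine ContinuousAt.eventually_mem (f := fun z => (R z).row) ?_
      (isOpen_setOfPred_linearIndependent.mem_nhds hRli)
    exact (continuous_pi fun s => continuous_pi fun j => (hR s j).continuous).continuousAt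
  have hmem := eventually_mem_span_of_partialDeriv_mem_span hR hRli (by
    filter_upwards [hev] with z hz i s
    have h1 : (fun j => partialDeriv i (fun w => R w s j) z) =
        wronskianRow F z (S s + Pi.single i 1) := by
      ext j
      exact (congrFun (diffOp_add_single (hF j) (S s) i) z).symm
    -- The differentiated row has order at most `s + 1 ≤ k + 1`, so it cannot extend the family; as
    -- the old rows are independent at `z`, it lies in their span.
    have h2 := hcon (S s + Pi.single i 1) (by
      rw [order_add_single]
      have := hS s
      omega) z
    rw [Fin.comp_snoc, linearIndependent_finSnoc] at h2
    rw [h1]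
    by_contra h3
    exact h2 ⟨hz, h3⟩)
  -- The order bound at index 0 makes the first row `F` itself.
  have hS0 : S 0 = 0 := by
    have h := hS 0
    simp only [order, Fin.val_zero, nonpos_iff_eq_zero, Finset.sum_eq_zero_iff,
      Finset.mem_univ, true_implies] at h
    exact funext h
  have hlt : Submodule.span ℂ (Set.range (R z₀).row) < ⊤ := by
    refine Submodule.lt_top_of_finrank_lt_finrank ?_
    rw [finrank_span_eq_card hRli]
    simp [hk]
  obtain ⟨l, hl0, hl⟩ := Submodule.exists_le_ker_of_lt_top _ hlt
  obtain ⟨z, hz⟩ := hlin l hl0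
  refine hz (eq_zero_of_eventuallyEq_zero (g := fun z => l fun j => F j z) ?_ (z₀ := z₀) ?_ z)
  · exact l.toContinuousLinearMap.differentiable.comp (differentiable_pi.2 hF)
  · filter_upwards [hmem] with w hw
    have h := hl (hw 0)
    have hrow : R w 0 = fun j => F j w := by
      ext j
      simp [R, wronskianRow, hS0, diffOp_zero]
    rwa [LinearMap.mem_ker, hrow] at h

/-- At a point where `[F_0 : … : F_n]` is an immersion, `F` and its first partial derivatives are
linearly independent. -/
theorem linearIndependent_of_isOfMaximalRank {p n : ℕ} (hpn : p ≤ n) {f : Cp p → CPn n}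
    (hrank : IsOfMaximalRank f) {F : Fin (n + 1) → Cp p → ℂ} (hF : IsReducedRepresentation F f) :
    ∃ z, LinearIndependent ℂ (wronskianRow F z ∘
      (Fin.cons 0 fun i => Pi.single i 1 : Fin (p + 1) → Fin p → ℕ)) := by
  obtain ⟨z, i₀, hz, hrk⟩ := hrank
  obtain ⟨hd, hrep⟩ := hF
  refine ⟨z, ?_⟩
  have hchart : (fun w => affineChart i₀ (f w)) =
      fun w j => F (i₀.succAbove j) w / F i₀ w := by
    funext w
    obtain ⟨h, hw⟩ := hrep w
    rw [hw, affineChart_mk]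
  have hi₀ : F i₀ z ≠ 0 := by
    obtain ⟨h, hw⟩ := hrep z
    rwa [hw, mk_mem_affineOpen] at hz
  rw [hchart, min_eq_left hpn] at hrk
  set D := fderiv ℂ (fun w j => F (i₀.succAbove j) w / F i₀ w) z with hD
  have hinj : Function.Injective D := by
    have h := LinearMap.finrank_range_add_finrank_ker (D : Cp p →ₗ[ℂ] Fin n → ℂ)
    have hrk' : Module.finrank ℂ (LinearMap.range (D : Cp p →ₗ[ℂ] Fin n → ℂ)) = p := hrk
    rw [hrk', Module.finrank_fin_fun] at h
    exact LinearMap.ker_eq_bot.1 (Submodule.finrank_eq_zero.1 (by omega))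
  have hDapp : ∀ v j, D v j = (F i₀ z * fderiv ℂ (F (i₀.succAbove j)) z v -
      F (i₀.succAbove j) z * fderiv ℂ (F i₀) z v) / F i₀ z ^ 2 := fun v j => by
    have h : HasFDerivAt (fun w j => F (i₀.succAbove j) w * (F i₀ w)⁻¹) _ z :=
      hasFDerivAt_pi.2 fun j => (hd (i₀.succAbove j) z).hasFDerivAt.mul
        ((hasDerivAt_inv hi₀).comp_hasFDerivAt z (hd i₀ z).hasFDerivAt)
    simp only [hD, div_eq_mul_inv, h.fderiv, ContinuousLinearMap.coe_pi', add_apply, smul_apply,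
      smul_eq_mul]
    field_simp
    ring
  rw [Fintype.linearIndependent_iff]
  intro c hc
  have hc' : ∀ j, c 0 * F j z + fderiv ℂ (F j) z (fun i => c i.succ) = 0 := fun j => by
    have := congrFun hc j
    rw [Fin.sum_univ_succ] at this
    simpa [wronskianRow, diffOp_zero, diffOp_single (hd j), fderiv_apply_eq_sum] using this
  -- A relation says that the derivative of `F` along `v` is `-c 0` times `F`; the quotient rule
  -- then gives `D v = 0`.
  have hv : (fun i : Fin p => c i.succ) = 0 := by
    refine hinj (funext fun j => ?_)
    rw [hDapp, map_zero, eq_neg_of_add_eq_zero_right (hc' (i₀.succAbove j)),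
      eq_neg_of_add_eq_zero_right (hc' i₀)]
    simp
    ring_nf
    simp
  refine Fin.cases ?_ fun i => congrFun hv i
  have := hc' i₀
  rw [hv] at this
  simpa [hi₀] using this

end GenWronskian

theorem mainTheorem2 {p n : ℕ} (hp : 1 ≤ p) (hpn : p ≤ n)
    (f : GenWronskian.Cp p → GenWronskian.CPn n)
    (hf : GenWronskian.IsHolomorphicMap f)
    (hlin : GenWronskian.IsLinearlyNondegenerate f)
    (hrank : GenWronskian.IsOfMaximalRank f)
    (F : Fin (n + 1) → GenWronskian.Cp p → ℂ)
    (hF : GenWronskian.IsReducedRepresentation F f) :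
    ∃ S : Fin (n + 1) → Fin p → ℕ,
      GenWronskian.IsAdmissible S ∧
      p ≤ {α : Fin p → ℕ | α ∈ Set.range S ∧ GenWronskian.order α = 1}.ncard ∧
      ∃ z : GenWronskian.Cp p, GenWronskian.genWronskian S F z ≠ 0 := by
  have hnd : ∀ l : Module.Dual ℂ (Fin (n + 1) → ℂ), l ≠ 0 → ∃ z, l (fun j => F j z) ≠ 0 := by
    intro l hl
    by_contra! h
    refine hlin l hl ?_
    rintro _ ⟨z, rfl⟩
    obtain ⟨hz, hfz⟩ := hF.2 z
    obtain ⟨a, ha⟩ := Projectivization.exists_smul_eq_mk_rep ℂ _ hz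
    simp [GenWronskian.hyperplane, hfz, ← ha, Units.smul_def, h z]
  -- The induction starts at `k = p`, where indices 1 to `p` hold the first-order operators. The
  -- point `z` may change at each step.
  have main : ∀ k, p ≤ k → k ≤ n → ∃ S : Fin (k + 1) → Fin p → ℕ,
      (∀ s, GenWronskian.order (S s) ≤ s) ∧ (∀ i, Pi.single i 1 ∈ Set.range S) ∧
      ∃ z, LinearIndependent ℂ (GenWronskian.wronskianRow F z ∘ S) := by
    intro k hk
    induction k, hk using Nat.le_induction with
    | base =>
      intro _
      refine ⟨Fin.cons 0 fun i => Pi.single i 1, fun s => ?_, fun i => ⟨i.succ, Fin.cons_succ _ _ _⟩,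
        GenWronskian.linearIndependent_of_isOfMaximalRank hpn hrank hF⟩
      refine Fin.cases ?_ (fun i => ?_) s
      · exact GenWronskian.order_zero.le
      · exact (GenWronskian.order_single i).le.trans (by simp)
    | succ k hk ih =>
      intro hkn
      obtain ⟨S, hS, hmem, z₀, hli⟩ := ih (by omega)
      obtain ⟨α, hα, hz⟩ := GenWronskian.exists_linearIndependent_snoc hF.1 hnd hkn hS hli
      refine ⟨Fin.snoc S α, fun s => ?_, fun i => ?_, hz⟩
      · refine Fin.lastCases ?_ (fun s => ?_) s
        · simpa using hα
        · simpa using hS s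
      · obtain ⟨s, hs⟩ := hmem i
        exact ⟨s.castSucc, by simpa using hs⟩
  obtain ⟨S, hS, hmem, z, hli⟩ := main n hpn le_rfl
  refine ⟨S, hS, ?_, z, ?_⟩
  · have hinj : Function.Injective fun i : Fin p => (Pi.single i 1 : Fin p → ℕ) := fun i j h => by
      simpa [Pi.single_apply] using congrFun h i
    calc p = (Set.range fun i : Fin p => (Pi.single i 1 : Fin p → ℕ)).ncard := by
          rw [Set.ncard_eq_toFinset_card', Set.toFinset_range,
            Finset.card_image_of_injective _ hinj, Finset.card_fin]
      _ ≤ _ := by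
          refine Set.ncard_le_ncard ?_ ((Set.finite_range S).subset fun α h => h.1)
          rintro _ ⟨i, rfl⟩
          exact ⟨hmem i, GenWronskian.order_single i⟩
  · have h : LinearIndependent ℂ (Matrix.of fun s j : Fin (n + 1) =>
        GenWronskian.diffOp (S s) (F j) z).row := hli
    rw [Matrix.linearIndependent_rows_iff_isUnit, Matrix.isUnit_iff_isUnit_det] at h
    exact h.ne_zero
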